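/- \textbf{Setup.} Let $K,N\ge 1$ be integers and let $M\in[0,N)$ be real. For a positive integer $F$, a library consists of $N$ messages $W=(W_1,\dots,W_N)\in\{1,\dots,2^F\}^N$. A pair $(R,M)$ of reals is \emph{achievable (in the worst-case scenario)} if for every $\epsilon>0$ and all sufficiently large $F$ there are caching functions $g_k:\{1,\dots,2^F\}^N\to\{1,\dots,\lfloor 2^{FM}\rfloor\}$ for $1\le k\le K$ and, for every demand vector $\mathbf d=(d_1,\dots,d_K)\in\{1,\dots,N\}^K$, an encoding function $f_{\mathbf d}:\{1,\dots,2^F\}^N\to\mathcal X:=\{1,\dots,\lfloor 2^{F(R+\epsilon)}\rfloor\}$ and decoding functions $\varphi_{k,\mathbf d}:\mathcal X\times\{1,\dots,\lfloor 2^{FM}\rfloor\}\to\{1,\dots,2^F\}$ such that $\varphi_{k,\mathbf d}(f_{\mathbf d}(W),g_k(W))=W_{d_k}$ for all $k$, $\mathbf d$ and $W$. Let $R^\star_{\mathrm{worst}}(M)$ be the infimum of all $R$ such that $(R,M)$ is achievable. With $\bar N:=\min\{K,N\}$ put $$R^{\mathrm{low}}_{\mathrm{worst}}(M):=\max\Big\{\max_{1\le\ell\le\bar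 N}\Big[\ell-M\frac{\ell^2}{N}\Big],\ \max_{1\le\ell\le\bar N}\Big[\ell-M\sum_{k=1}^{\ell}\frac{k}{N-k+1}\Big]\Big\},$$ and for a positive integer $\ell$ and $a\in(0,1)$ put $$\phi(a,\ell):=\frac{\frac{a(\ell+1)}{(1-a)\ell}\Big(1-\big(\frac{\ell+a}{\ell+1}\big)^{\ell/a}\Big)}{1-(1-a)\sum_{j=0}^{\ell-1}\frac{1}{\ell-aj}}.$$ \textbf{Theorem.} The function $\phi$ is bounded above on $(0,1)\times\mathbb Z^+$, and for all integers $K,N\ge1$ and all $M\in[0,N)$, $$\frac{R^\star_{\mathrm{worst}}(M)}{R^{\mathrm{low}}_{\mathrm{worst}}(M)}\ \le\ \sup_{\ell\in\mathbb Z^+}\ \sup_{a\in(0,1)}\phi(a,\ell).$$ -/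

import Mathlib

noncomputable section

namespace CodedCaching

/-- A library of `N` messages of `F` bits each: `W d` is the value of message `d`. -/
abbrev Library (N F : ℕ) : Type := Fin N → Fin (2 ^ F)

/-- Caching, encoding and decoding functions for `K` receivers and `N` messages of `F` bits,
with cache alphabet of size `V` and a delivery alphabet of size `X` that does not depend on
the demand vector. -/
structure Code (K N F V X : ℕ) where
  /-- caching functions `g_k`, chosen before the demands are known -/
  cache : Fin K → Library N F → Fin V
  /-- encoding functions `f_d` -/
  encode : (Fin K → Fin N) → Library N F → Fin X
  /-- decoding functions `φ_{k,d}` -/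
  decode : Fin K → (Fin K → Fin N) → Fin X → Fin V → Fin (2 ^ F)

/-- Every receiver perfectly reconstructs its demanded message, for every demand vector and
every realization of the library. -/
def Code.Correct {K N F V X : ℕ} (c : Code K N F V X) : Prop :=
  ∀ (d : Fin K → Fin N) (W : Library N F) (k : Fin K),
    c.decode k d (c.encode d W) (c.cache k W) = W (d k)

/-- The rate-memory pair `(R, M)` is achievable in the worst-case scenario: for every `ε > 0`
and all sufficiently large `F` there is a correct code with cache alphabet
`{1, …, ⌊2 ^ (F M)⌋}` and delivery alphabet `{1, …, ⌊2 ^ (F (R + ε))⌋}`. -/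
def AchievableWorst (K N : ℕ) (R M : ℝ) : Prop :=
  ∀ ε : ℝ, 0 < ε → ∃ F₀ : ℕ, ∀ F : ℕ, F₀ ≤ F → 0 < F →
    ∃ c : Code K N F ⌊(2 : ℝ) ^ ((F : ℝ) * M)⌋₊ ⌊(2 : ℝ) ^ ((F : ℝ) * (R + ε))⌋₊, c.Correct

/-- The worst-case rate-memory tradeoff `R*_worst(M)`. -/
def rateWorst (K N : ℕ) (M : ℝ) : ℝ :=
  sInf {R : ℝ | AchievableWorst K N R M}

/-- The lower bound `R_worst^low(M)`; both suprema are maxima over the finite set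
`{1, …, min K N}`. -/
def rateWorstLow (K N : ℕ) (M : ℝ) : ℝ :=
  max
    (⨆ l : Finset.Icc 1 (min K N), (((l : ℕ) : ℝ) - M * (((l : ℕ) : ℝ) ^ 2 / (N : ℝ))))
    (⨆ l : Finset.Icc 1 (min K N),
      (((l : ℕ) : ℝ) - M * ∑ k ∈ Finset.Icc 1 (l : ℕ), (k : ℝ) / ((N : ℝ) - (k : ℝ) + 1)))

/-- The function `φ(a, ℓ)`. -/
def phi (a : ℝ) (l : ℕ) : ℝ :=
  (a * ((l : ℝ) + 1) / ((1 - a) * (l : ℝ)) *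
      (1 - (((l : ℝ) + a) / ((l : ℝ) + 1)) ^ ((l : ℝ) / a))) /
    (1 - (1 - a) * ∑ j ∈ Finset.range l, 1 / ((l : ℝ) - a * (j : ℝ)))

/-- The set of all values `φ(a, ℓ)` for positive integers `ℓ` and `a ∈ (0, 1)`. -/
def phiValues : Set ℝ :=
  {y : ℝ | ∃ l : ℕ, 1 ≤ l ∧ ∃ a : ℝ, a ∈ Set.Ioo (0 : ℝ) 1 ∧ y = phi a l}

/-- Achievable rates are nonnegative, so the infimum defining `rateWorst` is over a set that
is bounded below. -/
theorem AchievableWorst.nonneg {K N : ℕ} (hN : 1 ≤ N) {R M : ℝ}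
    (h : AchievableWorst K N R M) : 0 ≤ R := by
  by_contra hR
  push Not at hR
  obtain ⟨F₀, hF⟩ := h (-R / 2) (by linarith)
  obtain ⟨c, -⟩ := hF (F₀ + 1) (by omega) (by omega)
  have x := c.encode (fun _ => ⟨0, hN⟩) (fun _ => ⟨0, by positivity⟩)
  have h0 : ⌊(2 : ℝ) ^ (((F₀ + 1 : ℕ) : ℝ) * (R + -R / 2))⌋₊ = 0 := by
    rw [Nat.floor_eq_zero]
    apply Real.rpow_lt_one_of_one_lt_of_neg (by norm_num)
    apply mul_neg_of_pos_of_neg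
    · positivity
    · linarith
  rw [h0] at x
  exact x.elim0

/-- Sending the whole library is always possible, so the infimum defining `rateWorst` is over
a nonempty set. -/
theorem achievableWorst_library (K N : ℕ) {M : ℝ} (hM : 0 ≤ M) :
    AchievableWorst K N (N : ℝ) M := by
  intro ε hε
  refine ⟨0, fun F _ _ => ?_⟩
  have hV : 0 < ⌊(2 : ℝ) ^ ((F : ℝ) * M)⌋₊ := by
    rw [Nat.floor_pos]
    exact Real.one_le_rpow (by norm_num) (by positivity)
  have hX : Fintype.card (Library N F) ≤
      Fintype.card (Fin ⌊(2 : ℝ) ^ ((F : ℝ) * ((N : ℝ) + ε))⌋₊) := by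
    simp only [Fintype.card_pi, Fintype.card_fin, Finset.prod_const, Finset.card_univ]
    apply Nat.le_floor
    rw [← pow_mul]
    push_cast
    rw [← Real.rpow_natCast]
    apply Real.rpow_le_rpow_of_exponent_le (by norm_num)
    push_cast
    have : (0 : ℝ) ≤ (F : ℝ) * ε := by positivity
    linarith
  obtain ⟨e⟩ := Function.Embedding.nonempty_of_card_le hX
  have : Nonempty (Library N F) := ⟨fun _ => ⟨0, by positivity⟩⟩
  refine ⟨⟨fun _ _ => ⟨0, hV⟩, fun _ W => e W,
    fun k d x _ => Function.invFun e x (d k)⟩, ?_⟩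
  intro d W k
  simp only [Function.leftInverse_invFun e.injective W]

end CodedCaching

end

namespace CodedCaching

/-! Put n = min K N and t = M / N. Caching each bit independently at each receiver with probability
t suggests subfile proportions for which the rate (1 - t) + ... + (1 - t)^n is achievable
(`achievableWorst_schemeRate`). Only n powers appear because the coded symbols for sets containing
no leader (one chosen receiver per demanded file) are redundant (`broadcast_eq_zero`).

On the other side, the second family in `rateWorstLow` dominates the lines `lowerLine n l`.
Consecutive lines meet at `corner n l`, and there rate / line is exactly `phi (l / n) l` for 1 ≤ l <
n (`schemeRate_corner`). Between corners the rate is convex in t while the line is affine, so the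
bound by `sSup phiValues` passes from the corners to all t (`exists_schemeRate_le`). -/

/-! ### Boundedness of `phi` -/

theorem half_le_phi_denominator {a : ℝ} (ha : a ∈ Set.Ioo (0 : ℝ) 1) {l : ℕ} (hl : 1 ≤ l) :
    a / 2 ≤ 1 - (1 - a) * ∑ j ∈ Finset.range l, 1 / ((l : ℝ) - a * (j : ℝ)) := by
  obtain ⟨ha0, ha1⟩ := ha
  have hl' : (0 : ℝ) < l := by exact_mod_cast hl
  -- Convexity in j: the right side is the chord through j = 0 and j = l.
  have hterm : ∀ j ∈ Finset.range l, (1 - a) * (1 / ((l : ℝ) - a * (j : ℝ))) ≤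
      (1 - a) / l + a / (l : ℝ) ^ 2 * j := by
    intro j hj
    have hjl : (j : ℝ) < l := by exact_mod_cast Finset.mem_range.mp hj
    have hj0 : (0 : ℝ) ≤ j := j.cast_nonneg
    have hpos : 0 < (l : ℝ) - a * j := by nlinarith
    have key : (1 - a) / l + a / (l : ℝ) ^ 2 * j = ((1 - a) * l + a * j) / (l : ℝ) ^ 2 := by
      field_simp
    rw [key, mul_one_div, div_le_div_iff₀ hpos (by positivity)]
    have : 0 ≤ a ^ 2 * j * (l - j) := by
      have := sub_pos.mpr hjl
      positivity
    nlinarith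
  have hsum : ∀ n : ℕ, ∑ j ∈ Finset.range n, (j : ℝ) = n * (n - 1) / 2 := by
    intro n
    induction n with
    | zero => simp
    | succ n ih => rw [Finset.sum_range_succ, ih]; push_cast; ring
  have h := Finset.sum_le_sum hterm
  rw [← Finset.mul_sum, Finset.sum_add_distrib, ← Finset.mul_sum, hsum, Finset.sum_const,
    Finset.card_range, nsmul_eq_mul] at h
  have e1 : (l : ℝ) * ((1 - a) / l) = 1 - a := by field_simp
  have e2 : a / (l : ℝ) ^ 2 * (l * (l - 1) / 2) = a / 2 - a / (2 * l) := by field_simp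
  have e3 : 0 ≤ a / (2 * l) := by positivity
  linarith

/-- The denominator is at least a / 2. Bernoulli bounds the numerator by 1, which settles a > 1/2;
for a ≤ 1/2 the prefactor gives 4a, cancelling the vanishing denominator. -/
theorem phi_le_eight {a : ℝ} (ha : a ∈ Set.Ioo (0 : ℝ) 1) {l : ℕ} (hl : 1 ≤ l) :
    phi a l ≤ 8 := by
  have hden := half_le_phi_denominator ha hl
  obtain ⟨ha0, ha1⟩ := ha
  have hl' : (1 : ℝ) ≤ l := by exact_mod_cast hl
  have hl0 : (0 : ℝ) < l := by linarith
  have h1a : 0 < 1 - a := by linarith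
  unfold phi
  rw [div_le_iff₀ (by linarith)]
  set c : ℝ := a * ((l : ℝ) + 1) / ((1 - a) * l) with hc
  set X : ℝ := (((l : ℝ) + a) / ((l : ℝ) + 1)) ^ ((l : ℝ) / a) with hX
  have hc0 : 0 < c := by positivity
  have hX0 : 0 ≤ X := by positivity
  have hnum1 : c * (1 - X) ≤ 1 := by
    have hp : 1 ≤ (l : ℝ) / a := by rw [le_div_iff₀ ha0]; linarith
    have hs : -1 ≤ -((1 - a) / ((l : ℝ) + 1)) := by
      rw [neg_le_neg_iff, div_le_one (by positivity)]; linarith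
    have hb := one_add_mul_self_le_rpow_one_add hs hp
    have e1 : 1 + -((1 - a) / ((l : ℝ) + 1)) = (l + a) / (l + 1) := by field_simp; ring
    rw [e1, ← hX] at hb
    have e2 : c * ((l : ℝ) / a * ((1 - a) / (l + 1))) = 1 := by
      rw [hc]; field_simp
    nlinarith
  rcases le_or_gt a (1 / 2) with h | h
  · have hnum2 : c * (1 - X) ≤ 4 * a := by
      have : c ≤ 4 * a := by
        rw [hc, div_le_iff₀ (by positivity)]
        have : (1 / 2) * (l : ℝ) ≤ (1 - a) * l := by nlinarith
        nlinarith
      nlinarith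
    linarith
  · linarith

theorem bddAbove_phiValues : BddAbove phiValues := by
  refine ⟨8, ?_⟩
  rintro y ⟨l, hl, a, ha, rfl⟩
  exact phi_le_eight ha hl

theorem phi_le_sSup {a : ℝ} (ha : a ∈ Set.Ioo (0 : ℝ) 1) {l : ℕ} (hl : 1 ≤ l) :
    phi a l ≤ sSup phiValues :=
  le_csSup bddAbove_phiValues ⟨l, hl, a, ha, rfl⟩

/-- Needed at t = 0, where rate and line coincide. At a = 1/2, l = 1 the exponent l / a is the
integer 2. -/
theorem one_le_sSup_phiValues : 1 ≤ sSup phiValues := by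
  have h := phi_le_sSup (a := 1 / 2) (l := 1) ⟨by norm_num, by norm_num⟩ le_rfl
  have e : phi (1 / 2) 1 = 7 / 4 := by
    have : ((1 : ℕ) : ℝ) / (1 / 2) = ((2 : ℕ) : ℝ) := by norm_num
    unfold phi
    rw [this, Real.rpow_natCast]
    norm_num
  linarith

/-! ### Comparing the scheme rate with the lower bound -/

/-- The `l`-th member of the second family in `rateWorstLow` for `N = n`, as a function of
`t = M / N`. -/
noncomputable def lowerLine (n l : ℕ) (t : ℝ) : ℝ :=
  l - t * ∑ k ∈ Finset.Icc 1 l, ((n : ℝ) * k) / (n - k + 1)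

/-- The value of `t` at which the `l`-th and `(l + 1)`-st bounds coincide. -/
noncomputable def corner (n l : ℕ) : ℝ := ((n : ℝ) - l) / (n * (l + 1))

/-- The rate of the decentralized scheme, as a function of `t = M / N`. -/
noncomputable def schemeRate (n : ℕ) (t : ℝ) : ℝ := ∑ i ∈ Finset.range n, (1 - t) ^ (i + 1)

theorem lowerLine_corner_succ {n l : ℕ} (hl : l < n) :
    lowerLine n (l + 1) (corner n l) = lowerLine n l (corner n l) := by
  have hn : (0 : ℝ) < n := by exact_mod_cast (Nat.zero_le l).trans_lt hl
  have hln : (0 : ℝ) < (n : ℝ) - l := by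
    have : (l : ℝ) < n := by exact_mod_cast hl
    linarith
  unfold lowerLine
  rw [Finset.sum_Icc_succ_top (by omega)]
  have : corner n l * ((n : ℝ) * ((l + 1 : ℕ) : ℝ) / (n - ((l + 1 : ℕ) : ℝ) + 1)) = 1 := by
    have e : (n : ℝ) - ((l + 1 : ℕ) : ℝ) + 1 = n - l := by push_cast; ring
    rw [e, corner]
    push_cast
    field_simp
  rw [mul_add, this]
  push_cast
  ring

theorem lowerLine_corner {n l : ℕ} (hl : 1 ≤ l) (hln : l < n) :
    lowerLine n l (corner n l) = (l : ℝ) * (n + 1) / (l + 1) *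
      (1 - (1 - (l : ℝ) / n) * ∑ j ∈ Finset.range l, 1 / ((l : ℝ) - (l : ℝ) / n * j)) := by
  have hn : (0 : ℝ) < n := by exact_mod_cast (Nat.zero_le l).trans_lt hln
  have hl0 : (0 : ℝ) < l := by exact_mod_cast hl
  have hsum : ∑ k ∈ Finset.Icc 1 l, ((n : ℝ) * k) / (n - k + 1) =
      (n + 1) * l * ∑ j ∈ Finset.range l, 1 / ((l : ℝ) - (l : ℝ) / n * j) - n * l := by
    have e : (n : ℝ) * l = ∑ j ∈ Finset.range l, (n : ℝ) := by simp [mul_comm]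
    rw [e, Finset.mul_sum, ← Finset.sum_sub_distrib, ← Finset.Ico_add_one_right_eq_Icc,
      Finset.sum_Ico_eq_sum_range, Nat.add_sub_cancel]
    refine Finset.sum_congr rfl fun j hj => ?_
    have hj' : (j : ℝ) < n := by exact_mod_cast (Finset.mem_range.mp hj).trans hln
    have h1 : (0 : ℝ) < n - j := by linarith
    have h2 : (n : ℝ) - ((1 + j : ℕ) : ℝ) + 1 = n - j := by push_cast; ring
    have h3 : (l : ℝ) - (l : ℝ) / n * j = l * (n - j) / n := by field_simp
    rw [h2, h3]
    push_cast
    field_simp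
    ring
  rw [lowerLine, hsum, corner]
  field_simp
  ring

theorem schemeRate_corner {n l : ℕ} (hl : 1 ≤ l) (hln : l < n) :
    schemeRate n (corner n l) = phi ((l : ℝ) / n) l * lowerLine n l (corner n l) := by
  have hn : (0 : ℝ) < n := by exact_mod_cast (Nat.zero_le l).trans_lt hln
  have hl0 : (0 : ℝ) < l := by exact_mod_cast hl
  have hlt : (l : ℝ) < n := by exact_mod_cast hln
  have hsub : (0 : ℝ) < n - l := by linarith
  have ha : (l : ℝ) / n ∈ Set.Ioo (0 : ℝ) 1 := ⟨by positivity, by rwa [div_lt_one hn]⟩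
  have hden := half_le_phi_denominator ha hl
  have hexp : (l : ℝ) / ((l : ℝ) / n) = n := by field_simp
  have hbase : ((l : ℝ) + (l : ℝ) / n) / (l + 1) = 1 - corner n l := by
    rw [corner]; field_simp; ring
  have hgeom : corner n l * schemeRate n (corner n l) =
      (1 - corner n l) * (1 - (1 - corner n l) ^ n) := by
    have := mul_geom_sum (1 - corner n l) n
    have e : schemeRate n (corner n l) =
        (1 - corner n l) * ∑ i ∈ Finset.range n, (1 - corner n l) ^ i := by
      rw [schemeRate, Finset.mul_sum]
      exact Finset.sum_congr rfl fun i _ => pow_succ' _ _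
    rw [e]
    linear_combination -(1 - corner n l) * this
  have hcpos : 0 < corner n l := by rw [corner]; positivity
  rw [lowerLine_corner hl hln, phi, hexp, hbase, Real.rpow_natCast]
  generalize 1 - (1 - (l : ℝ) / n) * ∑ j ∈ Finset.range l, 1 / ((l : ℝ) - (l : ℝ) / n * j) = D
    at hden ⊢
  have hD : D ≠ 0 := by have := ha.1; linarith
  apply mul_left_cancel₀ hcpos.ne'
  rw [hgeom]
  generalize 1 - (1 - corner n l) ^ n = Y
  rw [corner]
  field_simp
  ring

theorem schemeRate_le_of_mem_segment {n : ℕ} {C c₀ c₁ u v t : ℝ} (hut : u ≤ t) (htv : t ≤ v)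
    (hv : v ≤ 1) (hu : schemeRate n u ≤ C * (c₀ - u * c₁))
    (hv' : schemeRate n v ≤ C * (c₀ - v * c₁)) :
    schemeRate n t ≤ C * (c₀ - t * c₁) := by
  have hconv : ConvexOn ℝ (Set.Ici (0 : ℝ)) fun y => ∑ i ∈ Finset.range n, y ^ (i + 1) := by
    refine ⟨convex_Ici 0, fun x hx y hy a b ha hb hab => ?_⟩
    simp only [smul_eq_mul, Finset.mul_sum, ← Finset.sum_add_distrib]
    exact Finset.sum_le_sum fun i _ => (convexOn_pow (i + 1)).2 hx hy ha hb hab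
  obtain ⟨a, b, ha, hb, hab, rfl⟩ : t ∈ segment ℝ u v := by
    rw [segment_eq_Icc (hut.trans htv)]; exact ⟨hut, htv⟩
  have h := hconv.2 (x := 1 - u) (y := 1 - v) (by simp; linarith) (by simpa using hv) ha hb hab
  have e : a • (1 - u) + b • (1 - v) = 1 - (a • u + b • v) := by
    simp only [smul_eq_mul]; linear_combination hab
  rw [e] at h
  simp only [smul_eq_mul] at h ⊢
  calc schemeRate n (a * u + b * v) ≤ a * schemeRate n u + b * schemeRate n v := h
    _ ≤ a * (C * (c₀ - u * c₁)) + b * (C * (c₀ - v * c₁)) := by gcongr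
    _ = C * (c₀ - (a * u + b * v) * c₁) := by linear_combination C * c₀ * hab

theorem exists_schemeRate_le {n : ℕ} (hn : 1 ≤ n) {t : ℝ} (ht0 : 0 ≤ t) (ht1 : t < 1) :
    ∃ l, 1 ≤ l ∧ l ≤ n ∧ schemeRate n t ≤ sSup phiValues * lowerLine n l t := by
  have hn0 : (0 : ℝ) < n := by exact_mod_cast hn
  have hcorner : ∀ l, 1 ≤ l → l ≤ n →
      schemeRate n (corner n l) ≤ sSup phiValues * lowerLine n l (corner n l) := by
    intro l hl hln
    rcases hln.lt_or_eq with h | rfl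
    · have hlt : (l : ℝ) < n := by exact_mod_cast h
      have hl0 : (0 : ℝ) < l := by exact_mod_cast hl
      have ha : (l : ℝ) / n ∈ Set.Ioo (0 : ℝ) 1 := ⟨by positivity, by rwa [div_lt_one hn0]⟩
      rw [schemeRate_corner hl h]
      refine mul_le_mul_of_nonneg_right (phi_le_sSup ha hl) ?_
      rw [lowerLine_corner hl h]
      have := half_le_phi_denominator ha hl
      have := ha.1
      refine mul_nonneg (by positivity) (by linarith)
    · have e : corner l l = 0 := by simp [corner]
      have := one_le_sSup_phiValues
      simp only [e, schemeRate, lowerLine]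
      simp
      nlinarith
  have hex : ∃ l, corner n l ≤ t := ⟨n, by simpa [corner] using ht0⟩
  classical
  -- The least index with corner at most t is positive, as `corner n 0` is 1; hence t lies between
  -- corners m + 1 and m, and the line m + 1 serves at both ends.
  obtain ⟨m, hm⟩ : ∃ m, Nat.find hex = m + 1 := by
    refine Nat.exists_eq_succ_of_ne_zero fun h0 => ?_
    have h := Nat.find_spec hex
    rw [h0] at h
    have : corner n 0 = 1 := by simp [corner, hn0.ne']
    linarith
  have hlo : corner n (m + 1) ≤ t := hm ▸ Nat.find_spec hex
  have hhi : t < corner n m := not_le.mp (Nat.find_min hex (by omega))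
  have hmn : m + 1 ≤ n := hm ▸ Nat.find_min' hex (by simpa [corner] using ht0)
  refine ⟨m + 1, by omega, hmn, ?_⟩
  refine schemeRate_le_of_mem_segment hlo hhi.le ?_ (hcorner _ (by omega) hmn) ?_
  · rw [corner, div_le_one (by positivity)]
    have : (0 : ℝ) ≤ m := m.cast_nonneg
    nlinarith
  · change _ ≤ sSup phiValues * lowerLine n (m + 1) (corner n m)
    rw [lowerLine_corner_succ (by omega)]
    -- For m = 0 the right end is t = 1, where both sides vanish.
    rcases Nat.eq_zero_or_pos m with rfl | h
    · have : corner n 0 = 1 := by simp [corner, hn0.ne']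
      simp [this, schemeRate, lowerLine]
    · exact hcorner m h (by omega)

theorem schemeRate_le_mul_rateWorstLow {K N : ℕ} (hK : 1 ≤ K) (hN : 1 ≤ N) {M : ℝ}
    (hM0 : 0 ≤ M) (hMN : M < N) :
    schemeRate (min K N) (M / N) ≤ sSup phiValues * rateWorstLow K N M := by
  have hN0 : (0 : ℝ) < N := by exact_mod_cast hN
  obtain ⟨l, hl, hln, h⟩ := exists_schemeRate_le (n := min K N) (le_min hK hN)
    (div_nonneg hM0 hN0.le) ((div_lt_one hN0).mpr hMN)
  refine h.trans (mul_le_mul_of_nonneg_left ?_ (zero_le_one.trans one_le_sSup_phiValues))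
  refine le_trans ?_ (le_max_right _ _)
  refine le_trans ?_ (le_ciSup (f := fun l : Finset.Icc 1 (min K N) => ((l : ℕ) : ℝ) -
    M * ∑ k ∈ Finset.Icc 1 (l : ℕ), (k : ℝ) / ((N : ℝ) - (k : ℝ) + 1))
    (Set.finite_range _).bddAbove ⟨l, Finset.mem_Icc.mpr ⟨hl, hln⟩⟩)
  rw [lowerLine, Finset.mul_sum, Finset.mul_sum]
  refine sub_le_sub_left (Finset.sum_le_sum fun k hk => ?_) _
  obtain ⟨hk1, hkl⟩ := Finset.mem_Icc.mp hk
  have hk1' : (1 : ℝ) ≤ k := by exact_mod_cast hk1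
  have hkn : (k : ℝ) ≤ (min K N : ℕ) := by exact_mod_cast hkl.trans hln
  have hnN : ((min K N : ℕ) : ℝ) ≤ N := by exact_mod_cast min_le_right K N
  generalize ((min K N : ℕ) : ℝ) = n at hkn hnN ⊢
  rw [div_mul_eq_mul_div, mul_div_assoc]
  refine mul_le_mul_of_nonneg_left ?_ hM0
  rw [div_div, div_le_div_iff₀ (by linarith) (by nlinarith)]
  nlinarith [mul_nonneg (mul_nonneg (sub_nonneg.mpr hnN) (sub_nonneg.mpr hk1'))
    (zero_le_one.trans hk1')]

/-- The first family at l = 1 gives 1 - M / N. -/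
theorem rateWorstLow_pos {K N : ℕ} (hK : 1 ≤ K) (hN : 1 ≤ N) {M : ℝ} (hMN : M < N) :
    0 < rateWorstLow K N M := by
  have hN0 : (0 : ℝ) < N := by exact_mod_cast hN
  refine lt_of_lt_of_le ?_ (le_max_left _ _)
  refine lt_of_lt_of_le ?_ (le_ciSup (f := fun l : Finset.Icc 1 (min K N) => ((l : ℕ) : ℝ) -
    M * (((l : ℕ) : ℝ) ^ 2 / (N : ℝ)))
    (Set.finite_range _).bddAbove ⟨1, Finset.mem_Icc.mpr ⟨le_rfl, le_min hK hN⟩⟩)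
  have := (div_lt_one hN0).mpr hMN
  simp
  rwa [← div_eq_mul_inv]

end CodedCaching

/-! ### Redundancy of leaderless coded symbols -/

namespace CodedCaching

section Broadcast

variable {ι β A : Type*} [DecidableEq ι] [AddCommGroup A]

/-- The coded symbol for a set `S` of receivers: the sum of the subfiles demanded by each
member of `S` and cached by all others. -/
def broadcast (d : ι → β) (w : β → Finset ι → A) (S : Finset ι) : A :=
  ∑ k ∈ S, w (d k) (S.erase k)

theorem broadcast_sub (d : ι → β) (w w' : β → Finset ι → A) (S : Finset ι) :
    broadcast d (w - w') S = broadcast d w S - broadcast d w' S := by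
  simp [broadcast, Finset.sum_sub_distrib]

/-- Linear form of decoding: in the symbol for `insert k T`, every term but the wanted one is cached
by k. -/
theorem subfile_eq_zero {d : ι → β} {w : β → Finset ι → A} {k : ι}
    (hcache : ∀ i T, k ∈ T → w i T = 0) (h : broadcast d w = 0) (T : Finset ι) :
    w (d k) T = 0 := by
  by_cases hk : k ∈ T
  · exact hcache _ _ hk
  have h0 := congrFun h (insert k T)
  rw [broadcast, Finset.sum_eq_single k] at h0
  · simpa [Finset.erase_insert hk] using h0
  · intro l _ hl
    exact hcache _ _ (by simp [hl.symm])
  · simp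

variable [Module (ZMod 2) A]

/-- Precomposition with the removal of `k`, on functions of a set of receivers. -/
def eraseOp (k : ι) : Module.End (ZMod 2) (Finset ι → A) where
  toFun w S := if k ∈ S then w (S.erase k) else 0
  map_add' w w' := by ext S; by_cases h : k ∈ S <;> simp [h]
  map_smul' c w := by ext S; by_cases h : k ∈ S <;> simp [h]

theorem eraseOp_apply (k : ι) (w : Finset ι → A) (S : Finset ι) :
    eraseOp k w S = if k ∈ S then w (S.erase k) else 0 := rfl

/-- `eraseOp k` acts as multiplication by x_k, with functions of subsets read as squarefree
polynomials modulo all x_k². -/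
theorem eraseOp_mul_self (k : ι) : eraseOp (A := A) k * eraseOp k = 0 := by
  ext w S
  simp [eraseOp_apply]

theorem eraseOp_commute (k l : ι) : Commute (eraseOp (A := A) k) (eraseOp l) := by
  rcases eq_or_ne k l with rfl | h
  · exact Commute.refl _
  refine LinearMap.ext fun w => funext fun S => ?_
  by_cases hk : k ∈ S <;> by_cases hl : l ∈ S <;>
    simp [eraseOp_apply, hk, hl, h, h.symm, Finset.erase_right_comm (a := k)]

theorem end_add_self {V : Type*} [AddCommGroup V] [Module (ZMod 2) V]
    (f : Module.End (ZMod 2) V) : f + f = 0 := by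
  rw [← two_smul (ZMod 2) f, show (2 : ZMod 2) = 0 from rfl, zero_smul]

/-- Squares vanish and, in characteristic 2, so do the doubled cross terms. -/
theorem sum_eraseOp_mul_self (s : Finset ι) :
    (∑ k ∈ s, eraseOp (A := A) k) * ∑ k ∈ s, eraseOp k = 0 := by
  induction s using Finset.induction_on with
  | empty => simp
  | insert k s hk ih =>
    have hc : Commute (eraseOp (A := A) k) (∑ k ∈ s, eraseOp k) :=
      Commute.sum_right _ _ _ fun l _ => eraseOp_commute k l
    rw [Finset.sum_insert hk, add_mul, mul_add, mul_add, ih, eraseOp_mul_self, hc.eq, zero_add,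
      add_zero, end_add_self]

variable [Fintype ι] [DecidableEq β]

/-- The sum of `eraseOp k` over all receivers `k` demanding file `i`. -/
def demandOp (d : ι → β) (i : β) : Module.End (ZMod 2) (Finset ι → A) :=
  ∑ k with d k = i, eraseOp k

theorem demandOp_apply (d : ι → β) (i : β) (w : Finset ι → A) (S : Finset ι) :
    demandOp d i w S = ∑ k ∈ S with d k = i, w (S.erase k) := by
  simp only [demandOp, LinearMap.sum_apply, Finset.sum_apply, eraseOp_apply]
  rw [← Finset.sum_filter, Finset.filter_filter]
  refine Finset.sum_congr ?_ fun _ _ => rfl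
  ext k
  simp [and_comm]

theorem demandOp_commute (d : ι → β) (i j : β) :
    Commute (demandOp (A := A) d i) (demandOp d j) :=
  Commute.sum_left _ _ _ fun k _ => Commute.sum_right _ _ _ fun l _ => eraseOp_commute k l

theorem prod_demandOp_mul {d : ι → β} {L : List β} {i : β} (hi : i ∈ L) :
    (L.map (demandOp (A := A) d)).prod * demandOp d i = 0 := by
  induction L with
  | nil => simp at hi
  | cons j L ih =>
    rw [List.map_cons, List.prod_cons, mul_assoc]
    rcases List.mem_cons.mp hi with rfl | h
    · have hc : Commute (L.map (demandOp (A := A) d)).prod (demandOp d i) := by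
        refine Commute.list_prod_left _ _ fun x hx => ?_
        obtain ⟨j, -, rfl⟩ := List.mem_map.mp hx
        exact demandOp_commute d j i
      have hsq : demandOp (A := A) d i * demandOp d i = 0 := sum_eraseOp_mul_self _
      rw [hc.eq, ← mul_assoc, hsq, zero_mul]
    · rw [ih h, mul_zero]

/-- A function that vanishes on all sets meeting the leaders and is annihilated by the
product of the demand operators vanishes identically. -/
theorem eq_zero_of_prod_demandOp {d : ι → β} {u : β → ι} {L : List β} (hL : L.Nodup)
    (hu : ∀ i ∈ L, d (u i) = i) {f : Finset ι → A}
    (hf : ∀ i ∈ L, ∀ S, u i ∈ S → f S = 0) (h : (L.map (demandOp d)).prod f = 0) :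
    f = 0 := by
  induction L generalizing f with
  | nil => simpa using h
  | cons i L ih =>
    rw [List.nodup_cons] at hL
    have hswap : (L.map (demandOp d)).prod (demandOp d i f) = 0 := by
      have hc : Commute (L.map (demandOp (A := A) d)).prod (demandOp d i) := by
        refine Commute.list_prod_left _ _ fun x hx => ?_
        obtain ⟨j, -, rfl⟩ := List.mem_map.mp hx
        exact demandOp_commute d j i
      rw [← Module.End.mul_apply, hc.eq]
      simpa using h
    -- Removing a receiver that demands i cannot remove the leader of another file, so the vanishing
    -- hypothesis survives and induction applies.
    have hD : demandOp d i f = 0 := by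
      refine ih hL.2 (fun j hj => hu j (List.mem_cons_of_mem _ hj)) ?_ hswap
      intro j hj S hS
      rw [demandOp_apply]
      refine Finset.sum_eq_zero fun k hk => hf j (List.mem_cons_of_mem _ hj) _ ?_
      rw [Finset.mem_erase]
      refine ⟨fun hkj => hL.1 ?_, hS⟩
      rw [← (Finset.mem_filter.mp hk).2, ← hkj, hu j (List.mem_cons_of_mem _ hj)]
      exact hj
    have hui := hu i List.mem_cons_self
    funext S
    by_cases hS : u i ∈ S
    · exact hf i List.mem_cons_self S hS
    -- All terms except the removal of u i still contain this leader, leaving only f S.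
    have h0 := congrFun hD (insert (u i) S)
    rw [demandOp_apply, Finset.sum_eq_single (u i)] at h0
    · simpa [Finset.erase_insert hS] using h0
    · intro k _ hk
      refine hf i List.mem_cons_self _ ?_
      simp [hk.symm]
    · intro h
      simp [hui] at h

theorem broadcast_eq_sum_demandOp (d : ι → β) (w : β → Finset ι → A) :
    broadcast d w = ∑ i ∈ Finset.univ.image d, demandOp d i (w i) := by
  funext S
  simp only [Finset.sum_apply, demandOp_apply, broadcast]
  rw [← Finset.sum_fiberwise_of_maps_to (t := Finset.univ.image d) (g := d) (by simp)]
  refine Finset.sum_congr rfl fun i _ => Finset.sum_congr rfl fun k hk => ?_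
  rw [(Finset.mem_filter.mp hk).2]

/-- The broadcast is a sum of terms D_i w_i with D_i² = 0, so the product of all D_i kills it. -/
theorem broadcast_eq_zero {d : ι → β} {u : β → ι}
    (hu : ∀ i ∈ Finset.univ.image d, d (u i) = i) {w : β → Finset ι → A}
    (h : ∀ S, (∃ i ∈ Finset.univ.image d, u i ∈ S) → broadcast d w S = 0) :
    broadcast d w = 0 := by
  refine eq_zero_of_prod_demandOp (d := d) (u := u) (Finset.univ.image d).nodup_toList
    (fun i hi => hu i (by simpa using hi))
    (fun i hi S hS => h S ⟨i, by simpa using hi, hS⟩) ?_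
  rw [broadcast_eq_sum_demandOp, map_sum]
  refine Finset.sum_eq_zero fun i hi => ?_
  rw [← Module.End.mul_apply, prod_demandOp_mul (Finset.mem_toList.mpr hi), LinearMap.zero_apply]

end Broadcast

/-! ### From linear decoding to codes -/

theorem exists_code_of_separating {K N F V X : ℕ} {CT : Fin K → Type} [∀ k, Fintype (CT k)]
    {XT : (Fin K → Fin N) → Type} [∀ d, Fintype (XT d)]
    (hV : ∀ k, Fintype.card (CT k) ≤ V) (hX : ∀ d, Fintype.card (XT d) ≤ X)
    (g : ∀ k, Library N F → CT k) (f : ∀ d, Library N F → XT d)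
    (hsep : ∀ d k W W', f d W = f d W' → g k W = g k W' → W (d k) = W' (d k)) :
    ∃ c : Code K N F V X, c.Correct := by
  classical
  have hV' : ∀ k, Nonempty (CT k ↪ Fin V) := fun k =>
    Function.Embedding.nonempty_of_card_le (by simpa using hV k)
  have hX' : ∀ d, Nonempty (XT d ↪ Fin X) := fun d =>
    Function.Embedding.nonempty_of_card_le (by simpa using hX d)
  -- The decoder picks any library consistent with what it sees; separation makes the choice
  -- harmless.
  let eV := fun k => (hV' k).some
  let eX := fun d => (hX' d).some
  refine ⟨⟨fun k W => eV k (g k W), fun d W => eX d (f d W), fun k d x v =>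
    if h : ∃ W, eX d (f d W) = x ∧ eV k (g k W) = v then h.choose (d k)
    else ⟨0, by positivity⟩⟩, ?_⟩
  intro d W k
  have h : ∃ W', eX d (f d W') = eX d (f d W) ∧ eV k (g k W') = eV k (g k W) := ⟨W, rfl, rfl⟩
  simp only [dif_pos h]
  exact hsep d k _ _ ((eX d).injective h.choose_spec.1) ((eV k).injective h.choose_spec.2)

/-- The coded caching scheme with subfiles of sizes `s |T|`. -/
theorem exists_code_of_subfile_sizes {K N F V X : ℕ} (s : ℕ → ℕ)
    (hF : F ≤ ∑ T : Finset (Fin K), s T.card)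
    (hV : ∀ k : Fin K, 2 ^ (N * ∑ T : Finset (Fin K) with k ∈ T, s T.card) ≤ V)
    (hX : ∀ U : Finset (Fin K), U.card ≤ min K N →
      2 ^ (∑ S : Finset (Fin K) with ¬Disjoint S U, s (S.card - 1)) ≤ X) :
    ∃ c : Code K N F V X, c.Correct := by
  classical
  let P : Finset ((_ : Finset (Fin K)) × ℕ) := Finset.univ.sigma fun T => Finset.range (s T.card)
  obtain ⟨e⟩ : Nonempty (Fin F ↪ P) := by
    apply Function.Embedding.nonempty_of_card_le
    simpa [P] using hF
  have he : ∀ f, ((e f : (_ : Finset (Fin K)) × ℕ)).2 < s (e f : (_ : Finset (Fin K)) × ℕ).1.card := by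
    intro f
    exact Finset.mem_range.mp (Finset.mem_sigma.mp (e f).2).2
  let b : Fin (2 ^ F) ≃ (Fin F → ZMod 2) := Fintype.equivOfCardEq (by simp [ZMod.card])
  -- Bits are placed injectively into slots (T, j); unused slots and positions past s |T| hold 0, so
  -- all subfiles can be added.
  let sub : Library N F → Fin N → Finset (Fin K) → ℕ → ZMod 2 := fun W i T j =>
    ∑ f, if (e f : (_ : Finset (Fin K)) × ℕ) = ⟨T, j⟩ then b (W i) f else 0
  have hsub_zero : ∀ W i T j, s T.card ≤ j → sub W i T j = 0 := by
    intro W i T j hj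
    refine Finset.sum_eq_zero fun f _ => if_neg fun hf => ?_
    have := he f
    rw [hf] at this
    exact absurd this (not_lt.mpr hj)
  have hsub_inj : ∀ W W' i, (∀ T, sub W i T = sub W' i T) → W i = W' i := by
    intro W W' i h
    apply b.injective
    funext f
    have hf := congrFun (h (e f : (_ : Finset (Fin K)) × ℕ).1) (e f : (_ : Finset (Fin K)) × ℕ).2
    simpa [sub, Subtype.val_inj] using hf
  have hbc_zero : ∀ d W S j, s (S.card - 1) ≤ j → broadcast d (sub W) S j = 0 := by
    intro d W S j hj
    rw [broadcast, Finset.sum_apply]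
    refine Finset.sum_eq_zero fun k hk => hsub_zero _ _ _ _ ?_
    rwa [Finset.card_erase_of_mem hk]
  have hleader : ∀ d : Fin K → Fin N, Fin K → ∃ u : Fin N → Fin K,
      ∀ i ∈ Finset.univ.image d, d (u i) = i := by
    intro d k₀
    have : ∀ i, ∃ k, i ∈ Finset.univ.image d → d k = i := by
      intro i
      by_cases hi : i ∈ Finset.univ.image d
      · obtain ⟨k, -, hk⟩ := Finset.mem_image.mp hi
        exact ⟨k, fun _ => hk⟩
      · exact ⟨k₀, fun h => absurd h hi⟩
    choose u hu using this
    exact ⟨u, hu⟩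
  have hU : ∀ d : Fin K → Fin N, ∃ U : Finset (Fin K), U.card ≤ min K N ∧
      ∀ w : Fin N → Finset (Fin K) → ℕ → ZMod 2,
        (∀ S, ¬Disjoint S U → broadcast d w S = 0) → broadcast d w = 0 := by
    intro d
    rcases isEmpty_or_nonempty (Fin K) with hE | ⟨⟨k₀⟩⟩
    · refine ⟨∅, by simp, fun w _ => funext fun S => ?_⟩
      simp [Finset.eq_empty_of_isEmpty S, broadcast]
    obtain ⟨u, hu⟩ := hleader d k₀
    refine ⟨(Finset.univ.image d).image u, ?_, fun w h => broadcast_eq_zero hu fun S hS => ?_⟩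
    · refine Finset.card_image_le.trans (le_min ?_ ?_)
      · simpa using Finset.card_image_le (s := Finset.univ) (f := d)
      · simpa using Finset.card_le_univ (Finset.univ.image d)
    · obtain ⟨i, hi, hS⟩ := hS
      exact h S (Finset.not_disjoint_iff.mpr ⟨u i, hS, Finset.mem_image_of_mem u hi⟩)
  choose U hUcard hU using hU
  let I : Fin K → Finset ((_ : Finset (Fin K)) × ℕ) := fun k =>
    (Finset.univ.filter (k ∈ ·)).sigma fun T => Finset.range (s T.card)
  let J : (Fin K → Fin N) → Finset ((_ : Finset (Fin K)) × ℕ) := fun d =>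
    (Finset.univ.filter (¬Disjoint · (U d))).sigma fun S => Finset.range (s (S.card - 1))
  refine exists_code_of_separating (CT := fun k => Fin N × I k → ZMod 2)
    (XT := fun d => J d → ZMod 2) ?_ ?_ (fun k W p => sub W p.1 p.2.1.1 p.2.1.2)
    (fun d W p => broadcast d (sub W) p.1.1 p.1.2) ?_
  · intro k
    refine le_trans (le_of_eq ?_) (hV k)
    simp [I, ZMod.card]
  · intro d
    refine le_trans (le_of_eq ?_) (hX (U d) (hUcard d))
    simp [J, ZMod.card]
  · intro d k W W' hf hg
    apply hsub_inj
    intro T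
    rw [← sub_eq_zero]
    -- By linearity, two indistinguishable libraries reduce to their difference, whose cached
    -- subfiles and sent symbols are 0.
    refine subfile_eq_zero (d := d) (w := sub W - sub W') (k := k) ?_ (hU d _ ?_) T
    · intro i T hT
      funext j
      rw [Pi.sub_apply, Pi.sub_apply, Pi.sub_apply, Pi.zero_apply, sub_eq_zero]
      rcases lt_or_ge j (s T.card) with hj | hj
      · exact congrFun hg (i, ⟨⟨T, j⟩, by simp [I, hT, hj]⟩)
      · rw [hsub_zero _ _ _ _ hj, hsub_zero _ _ _ _ hj]
    · intro S hS
      rw [broadcast_sub, sub_eq_zero]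
      funext j
      rcases lt_or_ge j (s (S.card - 1)) with hj | hj
      · exact congrFun hf ⟨⟨S, j⟩, by simp [J, hS, hj]⟩
      · rw [hbc_zero _ _ _ _ hj, hbc_zero _ _ _ _ hj]

/-! ### Subset sums and subfile sizes -/

section SubsetSums

variable {K : ℕ}

theorem sum_subsets_mem_disjoint (q : ℝ) {U : Finset (Fin K)} {u : Fin K} (hu : u ∉ U) :
    ∑ S : Finset (Fin K) with u ∈ S ∧ Disjoint S U,
      q ^ (S.card - 1) * (1 - q) ^ (K - S.card) = (1 - q) ^ U.card := by
  have himg : (Finset.univ.filter fun S : Finset (Fin K) => u ∈ S ∧ Disjoint S U) =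
      ((insert u U)ᶜ).powerset.image (insert u) := by
    ext S
    simp only [Finset.mem_filter, Finset.mem_univ, true_and, Finset.mem_image,
      Finset.mem_powerset]
    constructor
    · rintro ⟨huS, hS⟩
      refine ⟨S.erase u, fun x hx => ?_, Finset.insert_erase huS⟩
      obtain ⟨hxu, hxS⟩ := Finset.mem_erase.mp hx
      simp [hxu, Finset.disjoint_left.mp hS hxS]
    · rintro ⟨T, hT, rfl⟩
      refine ⟨Finset.mem_insert_self _ _, ?_⟩
      rw [Finset.disjoint_insert_left]
      refine ⟨hu, Finset.disjoint_left.mpr fun x hx hxU => ?_⟩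
      have := hT hx
      simp [hxU] at this
  have hnot : ∀ T ∈ ((insert u U)ᶜ).powerset, u ∉ T := by
    intro T hT huT
    have := Finset.mem_powerset.mp hT huT
    simp at this
  have hcard : ((insert u U)ᶜ).card + (U.card + 1) = K := by
    have := Finset.card_compl_add_card (insert u U)
    rwa [Finset.card_insert_of_notMem hu, Fintype.card_fin] at this
  rw [himg, Finset.sum_image]
  · have hb := Finset.sum_pow_mul_eq_add_pow q (1 - q) ((insert u U)ᶜ)
    rw [add_sub_cancel, one_pow] at hb
    refine Eq.trans ?_ ((congrArg ((1 - q) ^ U.card * ·) hb).trans (mul_one _))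
    rw [Finset.mul_sum]
    refine Finset.sum_congr rfl fun T hT => ?_
    have hTc := Finset.card_le_card (Finset.mem_powerset.mp hT)
    rw [Finset.card_insert_of_notMem (hnot T hT), Nat.add_sub_cancel,
      show K - (T.card + 1) = U.card + (((insert u U)ᶜ).card - T.card) by omega, pow_add]
    ring
  · intro T hT T' hT' h
    rw [← Finset.erase_insert (hnot T hT), ← Finset.erase_insert (hnot T' hT'), h]

theorem sum_subsets (q : ℝ) :
    ∑ T : Finset (Fin K), q ^ T.card * (1 - q) ^ (K - T.card) = 1 := by
  have h := Finset.sum_pow_mul_eq_add_pow q (1 - q) (Finset.univ : Finset (Fin K))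
  simpa using h

theorem sum_subsets_mem (q : ℝ) (k : Fin K) :
    ∑ T : Finset (Fin K) with k ∈ T, q ^ T.card * (1 - q) ^ (K - T.card) = q := by
  have h := sum_subsets_mem_disjoint q (Finset.notMem_empty k)
  simp only [Finset.disjoint_empty_right, and_true, Finset.card_empty, pow_zero] at h
  calc _ = q * ∑ T : Finset (Fin K) with k ∈ T, q ^ (T.card - 1) * (1 - q) ^ (K - T.card) := by
        rw [Finset.mul_sum]
        refine Finset.sum_congr rfl fun T hT => ?_
        have hpos : 0 < T.card := Finset.card_pos.mpr ⟨k, (Finset.mem_filter.mp hT).2⟩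
        rw [← mul_assoc, mul_pow_sub_one hpos.ne']
    _ = q := by rw [h, mul_one]

/-- Adding a leader u to U adds the sets that contain u and avoid U, whose total is (1 - q)^(|U| +
1). -/
theorem sum_subsets_not_disjoint (q : ℝ) (U : Finset (Fin K)) :
    ∑ S : Finset (Fin K) with ¬Disjoint S U,
      q ^ (S.card - 1) * (1 - q) ^ (K - (S.card - 1)) = schemeRate U.card q := by
  induction U using Finset.induction_on with
  | empty => simp [schemeRate]
  | insert u U hu ih =>
    have hsplit : (Finset.univ.filter fun S : Finset (Fin K) => ¬Disjoint S (insert u U)) =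
        (Finset.univ.filter fun S : Finset (Fin K) => ¬Disjoint S U) ∪
          Finset.univ.filter fun S : Finset (Fin K) => u ∈ S ∧ Disjoint S U := by
      ext S
      simp only [Finset.mem_filter, Finset.mem_univ, true_and, Finset.mem_union,
        Finset.disjoint_insert_right]
      tauto
    have hdisj : Disjoint (Finset.univ.filter fun S : Finset (Fin K) => ¬Disjoint S U)
        (Finset.univ.filter fun S : Finset (Fin K) => u ∈ S ∧ Disjoint S U) := by
      rw [Finset.disjoint_filter]
      tauto
    rw [hsplit, Finset.sum_union hdisj, ih, Finset.card_insert_of_notMem hu, schemeRate,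
      schemeRate, Finset.sum_range_succ, pow_succ (1 - q) U.card,
      ← sum_subsets_mem_disjoint q hu, Finset.sum_mul]
    congr 1
    refine Finset.sum_congr rfl fun S hS => ?_
    have hpos : 0 < S.card := Finset.card_pos.mpr ⟨u, (Finset.mem_filter.mp hS).2.1⟩
    have hle : S.card ≤ K := by simpa using Finset.card_le_univ S
    rw [show K - (S.card - 1) = K - S.card + 1 by omega, pow_succ]
    ring

/-- The memory constraint has no slack, so sizes for nonempty T are rounded down; the lost bits, at
most 2^K, go to the uncached subfile T = ∅ and burden only the delivery. -/
theorem exists_subfile_sizes (K F : ℕ) {q : ℝ} (hq0 : 0 ≤ q) (hq1 : q ≤ 1) :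
    ∃ s : ℕ → ℕ, F ≤ ∑ T : Finset (Fin K), s T.card ∧
      (∀ j, 1 ≤ j → (s j : ℝ) ≤ F * (q ^ j * (1 - q) ^ (K - j))) ∧
      ∀ j, (s j : ℝ) ≤ F * (q ^ j * (1 - q) ^ (K - j)) + 2 ^ K := by
  have hq1' : 0 ≤ 1 - q := by linarith
  let p : ℕ → ℝ := fun j => F * (q ^ j * (1 - q) ^ (K - j))
  have hp : ∀ j, 0 ≤ p j := fun j => by positivity
  let r : ℕ := ∑ T ∈ Finset.univ.erase (∅ : Finset (Fin K)), ⌊p T.card⌋₊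
  have h1 : ∀ j, 1 ≤ j → (((if j = 0 then F - r else ⌊p j⌋₊ : ℕ)) : ℝ) ≤ p j := by
    intro j hj
    rw [if_neg (by omega)]
    exact Nat.floor_le (hp j)
  refine ⟨fun j => if j = 0 then F - r else ⌊p j⌋₊, ?_, h1, fun j => ?_⟩
  · rw [← Finset.add_sum_erase _ _ (Finset.mem_univ ∅)]
    have : ∑ T ∈ Finset.univ.erase (∅ : Finset (Fin K)),
        (if T.card = 0 then F - r else ⌊p T.card⌋₊) = r := by
      refine Finset.sum_congr rfl fun T hT => if_neg ?_
      rw [Finset.card_eq_zero]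
      exact Finset.ne_of_mem_erase hT
    rw [this, Finset.card_empty]
    simp only [if_true]
    omega
  · rcases Nat.eq_zero_or_pos j with rfl | hj
    · change ((F - r : ℕ) : ℝ) ≤ p 0 + 2 ^ K
      have hsum : p 0 + ∑ T ∈ Finset.univ.erase (∅ : Finset (Fin K)), p T.card = F := by
        have h := Finset.add_sum_erase Finset.univ (fun T : Finset (Fin K) => p T.card)
          (Finset.mem_univ ∅)
        rw [Finset.card_empty] at h
        rw [h, ← Finset.mul_sum, sum_subsets, mul_one]
      have hr : ∑ T ∈ Finset.univ.erase (∅ : Finset (Fin K)), p T.card ≤ r + 2 ^ K := by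
        have hT : ∑ T ∈ Finset.univ.erase (∅ : Finset (Fin K)), p T.card ≤
            ∑ T ∈ Finset.univ.erase (∅ : Finset (Fin K)), ((⌊p T.card⌋₊ : ℝ) + 1) :=
          Finset.sum_le_sum fun T _ => (Nat.lt_floor_add_one _).le
        rw [Finset.sum_add_distrib, Finset.sum_const, nsmul_one] at hT
        have hc : ((Finset.univ.erase (∅ : Finset (Fin K))).card : ℝ) ≤ 2 ^ K := by
          have := Finset.card_le_univ (Finset.univ.erase (∅ : Finset (Fin K)))
          rw [Fintype.card_finset, Fintype.card_fin] at this
          exact_mod_cast this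
        have hr' : (r : ℝ) =
            ∑ T ∈ Finset.univ.erase (∅ : Finset (Fin K)), (⌊p T.card⌋₊ : ℝ) := by
          simp only [r]; push_cast; rfl
        linarith
      rcases le_total r F with h | h
      · rw [Nat.cast_sub h]
        linarith
      · rw [Nat.sub_eq_zero_of_le h, Nat.cast_zero]
        have := hp 0
        positivity
    · have := h1 j hj
      have h2 : (0 : ℝ) < 2 ^ K := by positivity
      exact this.trans (by linarith [this])

end SubsetSums

/-! ### Achievability and conclusion -/

theorem schemeRate_mono {q : ℝ} (hq : q ≤ 1) : Monotone fun n => schemeRate n q := by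
  intro m n h
  refine Finset.sum_le_sum_of_subset_of_nonneg (Finset.range_mono h) fun i _ _ => ?_
  have : 0 ≤ 1 - q := by linarith
  positivity

theorem two_pow_le_floor_rpow {m : ℕ} {x : ℝ} (h : (m : ℝ) ≤ x) : 2 ^ m ≤ ⌊(2 : ℝ) ^ x⌋₊ := by
  apply Nat.le_floor
  push_cast
  rw [← Real.rpow_natCast]
  exact Real.rpow_le_rpow_of_exponent_le (by norm_num) h

theorem achievableWorst_schemeRate (K : ℕ) {N : ℕ} (hN : 1 ≤ N) {M : ℝ} (hM0 : 0 ≤ M)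
    (hMN : M ≤ N) : AchievableWorst K N (schemeRate (min K N) (M / N)) M := by
  intro ε hε
  have hN0 : (0 : ℝ) < N := by exact_mod_cast hN
  set q : ℝ := M / N with hq
  have hq0 : 0 ≤ q := by positivity
  have hq1 : q ≤ 1 := by rwa [hq, div_le_one hN0]
  -- At most 2^K symbols, each with at most 2^K excess bits, must fit into F ε.
  refine ⟨⌈2 ^ K * 2 ^ K / ε⌉₊, fun F hF _ => ?_⟩
  have hF' : (2 : ℝ) ^ K * 2 ^ K ≤ F * ε := by
    rw [← div_le_iff₀ hε]
    exact Nat.ceil_le.mp hF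
  obtain ⟨s, hs, hs1, hs2⟩ := exists_subfile_sizes K F hq0 hq1
  refine exists_code_of_subfile_sizes s hs (fun k => two_pow_le_floor_rpow ?_)
    fun U hU => two_pow_le_floor_rpow ?_
  · push_cast
    calc (N : ℝ) * ∑ T : Finset (Fin K) with k ∈ T, (s T.card : ℝ)
        ≤ N * ∑ T : Finset (Fin K) with k ∈ T,
          (F : ℝ) * (q ^ T.card * (1 - q) ^ (K - T.card)) := by
          refine mul_le_mul_of_nonneg_left (Finset.sum_le_sum fun T hT => hs1 _ ?_) hN0.le
          exact Finset.card_pos.mpr ⟨k, (Finset.mem_filter.mp hT).2⟩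
      _ = F * M := by
          rw [← Finset.mul_sum, sum_subsets_mem, hq]
          field_simp
  · push_cast
    have hcard : ((Finset.univ.filter fun S : Finset (Fin K) => ¬Disjoint S U).card : ℝ) ≤
        2 ^ K := by
      have := Finset.card_le_univ (Finset.univ.filter fun S : Finset (Fin K) => ¬Disjoint S U)
      rw [Fintype.card_finset, Fintype.card_fin] at this
      exact_mod_cast this
    have hmono := schemeRate_mono hq1 hU
    calc ∑ S : Finset (Fin K) with ¬Disjoint S U, (s (S.card - 1) : ℝ)
        ≤ ∑ S : Finset (Fin K) with ¬Disjoint S U,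
          ((F : ℝ) * (q ^ (S.card - 1) * (1 - q) ^ (K - (S.card - 1))) + 2 ^ K) :=
          Finset.sum_le_sum fun S _ => hs2 _
      _ = F * schemeRate U.card q +
          (Finset.univ.filter fun S : Finset (Fin K) => ¬Disjoint S U).card * 2 ^ K := by
          rw [Finset.sum_add_distrib, ← Finset.mul_sum, sum_subsets_not_disjoint,
            Finset.sum_const, nsmul_eq_mul]
      _ ≤ F * schemeRate (min K N) q + 2 ^ K * 2 ^ K := by gcongr
      _ ≤ F * (schemeRate (min K N) q + ε) := by linarith

theorem rateWorst_le_schemeRate (K : ℕ) {N : ℕ} (hN : 1 ≤ N) {M : ℝ} (hM0 : 0 ≤ M)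
    (hMN : M ≤ N) : rateWorst K N M ≤ schemeRate (min K N) (M / N) :=
  csInf_le ⟨0, fun _ h => h.nonneg hN⟩ (achievableWorst_schemeRate K hN hM0 hMN)

end CodedCaching

theorem theorem2 (K N : ℕ) (hK : 1 ≤ K) (hN : 1 ≤ N) (M : ℝ) (hM0 : 0 ≤ M) (hMN : M < (N : ℝ)) :
    BddAbove CodedCaching.phiValues ∧
      CodedCaching.rateWorst K N M / CodedCaching.rateWorstLow K N M ≤
        sSup CodedCaching.phiValues := by
  refine ⟨CodedCaching.bddAbove_phiValues, ?_⟩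
  rw [div_le_iff₀ (CodedCaching.rateWorstLow_pos hK hN hMN)]
  exact (CodedCaching.rateWorst_le_schemeRate K hN hM0 hMN.le).trans
    (CodedCaching.schemeRate_le_mul_rateWorstLow hK hN hM0 hMN)
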